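/- Let $\mathcal X$ be a Polish space with its Borel $\sigma$-field, and let $d$ be a metric on $\mathcal X$ that is lower semicontinuous on $\mathcal X\times\mathcal X$ (for example, a metric inducing the topology of $\mathcal X$; in general $d$ need not induce it). Let $\theta:[0,\infty)\to[0,\infty)$ be a convex function with $\theta(0)=0$, let $c(x,y)=\theta(d(x,y))$, and let $\mu$ be a Borel probability measure on $\mathcal X$. Suppose that $\mu$ satisfies the transport-entropy inequality $\mathcal T_c\le H$, that is, $$\inf_{\pi}\int_{\mathcal X\times\mathcal X} c(x,y)\,d\pi(x,y)\ \le\ H(\nu|\mu)\qquad\text{for every Borel probability measure }\nu\text{ on }\mathcal X,$$ where the infimum runs over all probability measures $\pi$ on $\mathcal X\times\mathcal X$ with first marginal $\nu$ and second marginal $\mu$, and $H(\nu|\mu)=\int\log\frac{d\nu}{d\mu}\,d\nu$ if $\nu\ll\mu$, $H(\nu|\mu)=+\infty$ otherwise. Then the couple $(\mu,\tilde c)$ with $\tilde c(x,y)=2\,\theta\!\left(\frac{d(x,y)}{2}\right)$ satisfies Property $(\tau)$: for every bounded Borel function $f:\mathcal X\to\mathbb R$, the function $Q_{\tilde c}f(x)=\inf_{y\in\mathcal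 X}\{f(y)+\tilde c(x,y)\}$ is measurable with respect to the $\mu$-completion of the Borel $\sigma$-field, and $$\left(\int e^{Q_{\tilde c}f}\,d\mu\right)\left(\int e^{-f}\,d\mu\right)\le 1.$$ -/

import Mathlib

open MeasureTheory Set
open scoped ENNReal

namespace TransportTau

/-- `d` is a metric (distance function) on the set `X`. Nonnegativity follows from the axioms.
The metric need not induce a topology that `X` may already carry. -/
structure IsMetric {X : Type*} (d : X → X → ℝ) : Prop where
  eq_zero_iff : ∀ x y, d x y = 0 ↔ x = y
  symm : ∀ x y, d x y = d y x
  triangle : ∀ x y z, d x z ≤ d x y + d y z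

/-- `π` is a coupling of `ν` and `μ`: its first marginal is `ν` and its second marginal is `μ`. -/
def IsCoupling {X : Type*} [MeasurableSpace X] (π : Measure (X × X)) (ν μ : Measure X) : Prop :=
  π.map Prod.fst = ν ∧ π.map Prod.snd = μ

/-- The optimal transport cost `𝒯_c(ν, μ) = inf_π ∫ c dπ ∈ [0, ∞]`, for a nonnegative cost `c`,
the infimum being over all couplings `π` of `ν` and `μ`. -/
noncomputable def transportCost {X : Type*} [MeasurableSpace X] (c : X → X → ℝ)
    (ν μ : Measure X) : ℝ≥0∞ :=
  ⨅ (π : Measure (X × X)) (_ : IsCoupling π ν μ), ∫⁻ p, ENNReal.ofReal (c p.1 p.2) ∂π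

/-- The transport-entropy inequality `𝒯_c ≤ H`: one has `𝒯_c(ν, μ) ≤ H(ν|μ)` for every probability
measure `ν`. For probability measures, `InformationTheory.klDiv ν μ` is the relative entropy
`H(ν|μ) = ∫ log (dν/dμ) dν` if `ν ≪ μ` and `∞` otherwise. -/
def TransportEntropyInequality {X : Type*} [MeasurableSpace X] (c : X → X → ℝ)
    (μ : Measure X) : Prop :=
  ∀ ν : Measure X, IsProbabilityMeasure ν → transportCost c ν μ ≤ InformationTheory.klDiv ν μ

/-- The inf-convolution `Q_c f (x) = inf_y {f y + c x y}`. -/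
noncomputable def infConv {X : Type*} (c : X → X → ℝ) (f : X → ℝ) (x : X) : ℝ :=
  ⨅ y, (f y + c x y)

/-- Property (τ) for the couple `(μ, c)`: for each bounded Borel function `f`,
`(∫ exp (Q_c f) dμ) * (∫ exp (-f) dμ) ≤ 1`. As `Q_c f` need not be a Borel function, that the
first integral makes sense (`Q_c f` is measurable for the completion of `μ`) is stated too. -/
def PropertyTau {X : Type*} [MeasurableSpace X] (μ : Measure X) (c : X → X → ℝ) : Prop :=
  ∀ f : X → ℝ, Measurable f → (∃ M : ℝ, ∀ x, |f x| ≤ M) →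
    AEMeasurable (infConv c f) μ ∧
    (∫⁻ x, ENNReal.ofReal (Real.exp (infConv c f x)) ∂μ) *
      (∫⁻ x, ENNReal.ofReal (Real.exp (-f x)) ∂μ) ≤ 1

end TransportTau

/-! Testing the inequality on the tilted measure `μ.tilted u` gives its dual form: if `u x - v z ≤ c
x z`, then `∫ exp u dμ ≤ exp (∫ v dμ)` (`TransportEntropyInequality.lintegral_exp_le`). With `q =
Q_c f`, it applies to the pairs `(Q_c̃ f, q)` and `(-f, -q)`, and the two bounds multiply to `exp (∫
q - ∫ q) = 1`. The first pair is admissible because `c̃ x y ≤ c x z + c z y`, by convexity of `θ` at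
a midpoint.

Measurability: the sets `{Q f < t}` are projections of Borel sets, hence analytic, and analytic sets
are universally measurable by inner approximation with compact sets. -/

open Filter Topology

namespace TransportTau

/-! ### Universal measurability of analytic sets -/

section Analytic

variable {X : Type*}

/-- A continuous image of the Baire space is approximated from inside, in measure, by the images
of a decreasing sequence of boxes. -/
theorem exists_box_lt_measure_image [MeasurableSpace X] (μ : Measure X) (f : (ℕ → ℕ) → X)
    {a : ℝ≥0∞} (ha : a < μ (range f)) :
    ∃ k : ℕ → ℕ, ∀ n, a < μ (f '' {x | ∀ i < n, x i ≤ k i}) := by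
  -- Bounding one more coordinate keeps the measure above `a`: continuity along increasing unions
  -- needs no measurability.
  have step : ∀ (n : ℕ) (s : {s : Set (ℕ → ℕ) // a < μ (f '' s)}),
      ∃ m : ℕ, a < μ (f '' (s.1 ∩ {x | x n ≤ m})) := by
    rintro n ⟨s, hs⟩
    have hmono : Monotone fun m : ℕ => f '' (s ∩ {x | x n ≤ m}) := fun m m' h =>
      image_mono (inter_subset_inter_right _ fun x (hx : x n ≤ m) => hx.trans h)
    have hunion : ⋃ m : ℕ, f '' (s ∩ {x | x n ≤ m}) = f '' s := by
      rw [← image_iUnion, ← inter_iUnion]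
      congr 1
      exact inter_eq_left.2 fun x _ => mem_iUnion.2 ⟨x n, le_refl (x n)⟩
    rw [← hunion, hmono.measure_iUnion] at hs
    exact lt_iSup_iff.1 hs
  choose m hm using step
  let T : ℕ → {s : Set (ℕ → ℕ) // a < μ (f '' s)} := fun n =>
    Nat.rec ⟨univ, by rwa [image_univ]⟩ (fun n s => ⟨s.1 ∩ {x | x n ≤ m n s}, hm n s⟩) n
  have hT : ∀ n, (T n).1 ⊆ {x | ∀ i < n, x i ≤ m i (T i)} := by
    intro n
    induction n with
    | zero => intro x _ i hi; exact absurd hi (Nat.not_lt_zero i)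
    | succ n ih =>
      rintro x ⟨hx, hxn⟩ i hi
      rcases Nat.lt_succ_iff_lt_or_eq.1 hi with h | rfl
      · exact ih hx i h
      · exact hxn
  exact ⟨fun i => m i (T i), fun n => (T n).2.trans_le (measure_mono (image_mono (hT n)))⟩

variable [TopologicalSpace X]

/-- The image of an infinite box under a continuous map contains the intersection of the closures
of the images of its finite-dimensional approximations. -/
theorem iInter_closure_image_box_subset [TopologicalSpace.MetrizableSpace X] {f : (ℕ → ℕ) → X}
    (hf : Continuous f) (k : ℕ → ℕ) :
    ⋂ n, closure (f '' {x | ∀ i < n, x i ≤ k i}) ⊆ f '' (univ.pi fun i => Iic (k i)) := by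
  let _ := TopologicalSpace.metrizableSpaceMetric X
  intro y hy
  have hx : ∀ n : ℕ, ∃ x : ℕ → ℕ, (∀ i < n, x i ≤ k i) ∧ dist y (f x) < 1 / ((n : ℝ) + 1) := by
    intro n
    obtain ⟨_, ⟨x, hx, rfl⟩, hd⟩ := Metric.mem_closure_iff.1 (mem_iInter.1 hy n) _
      (Nat.one_div_pos_of_nat (α := ℝ) (n := n))
    exact ⟨x, hx, hd⟩
  choose x hx hxd using hx
  have hK : IsCompact (univ.pi fun i => Iic (k i)) :=
    isCompact_univ_pi fun i => (finite_Iic (k i)).isCompact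
  -- Truncation puts the sequence in the compact box, and coordinate `i` is unchanged once `n > i`.
  obtain ⟨z, hz, φ, hφ, hlim⟩ := hK.tendsto_subseq
    (x := fun n i => min (x n i) (k i)) fun n i _ => mem_Iic.2 (min_le_right _ _)
  have hlim' : Tendsto (fun n => x (φ n)) atTop (𝓝 z) := by
    rw [tendsto_pi_nhds] at hlim ⊢
    intro i
    refine (hlim i).congr' ?_
    filter_upwards [eventually_gt_atTop i] with n hn
    exact min_eq_left (hx _ i (hn.trans_le hφ.le_apply))
  have hfx : Tendsto (fun n => f (x n)) atTop (𝓝 y) := by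
    rw [tendsto_iff_dist_tendsto_zero]
    refine squeeze_zero (fun _ => dist_nonneg) (fun n => ?_) tendsto_one_div_add_atTop_nhds_zero_nat
    rw [dist_comm]
    exact (hxd n).le
  exact ⟨z, hz, tendsto_nhds_unique ((hf.tendsto z).comp hlim') (hfx.comp hφ.tendsto_atTop)⟩

/-- An analytic subset of a metrizable space is approximated in measure by its compact subsets. -/
theorem exists_isCompact_subset_range_le_measure [TopologicalSpace.MetrizableSpace X]
    [MeasurableSpace X] [BorelSpace X] (μ : Measure X) [IsFiniteMeasure μ] {f : (ℕ → ℕ) → X}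
    (hf : Continuous f) {a : ℝ≥0∞} (ha : a < μ (range f)) :
    ∃ K ⊆ range f, IsCompact K ∧ a ≤ μ K := by
  obtain ⟨k, hk⟩ := exists_box_lt_measure_image μ f ha
  refine ⟨f '' (univ.pi fun i => Iic (k i)), image_subset_range _ _,
    (isCompact_univ_pi fun i => (finite_Iic (k i)).isCompact).image hf, ?_⟩
  refine le_trans ?_ (measure_mono (iInter_closure_image_box_subset hf k))
  -- Images of boxes may fail to be measurable; their closures allow continuity from above.
  have hanti : Antitone fun n : ℕ => closure (f '' {x | ∀ i < n, x i ≤ k i}) := fun n n' h =>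
    closure_mono (image_mono fun x hx i hi => hx i (hi.trans_le h))
  rw [hanti.measure_iInter (fun n => isClosed_closure.measurableSet.nullMeasurableSet)
    ⟨0, measure_ne_top _ _⟩]
  exact le_iInf fun n => (hk n).le.trans (measure_mono subset_closure)

/-- Analytic sets are universally measurable. -/
theorem nullMeasurableSet_of_analyticSet [TopologicalSpace.MetrizableSpace X]
    [MeasurableSpace X] [BorelSpace X] (μ : Measure X) [IsFiniteMeasure μ] {s : Set X}
    (hs : AnalyticSet s) : NullMeasurableSet s μ := by
  rw [AnalyticSet] at hs
  rcases hs with rfl | ⟨f, hf, rfl⟩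
  · exact nullMeasurableSet_empty
  rcases eq_or_ne (μ (range f)) 0 with h0 | h0
  · exact NullMeasurableSet.of_null h0
  obtain ⟨a, -, ha, hlim⟩ := exists_seq_strictMono_tendsto' (pos_iff_ne_zero.2 h0)
  choose K hKs hK hKa using fun n =>
    exists_isCompact_subset_range_le_measure μ hf (ha n).2
  have hB : NullMeasurableSet (⋃ n, K n) μ :=
    (MeasurableSet.iUnion fun n => (hK n).measurableSet).nullMeasurableSet
  refine hB.congr (ae_eq_of_subset_of_measure_ge (iUnion_subset hKs) ?_ hB (measure_ne_top _ _))
  exact le_of_tendsto' hlim fun n => (hKa n).trans (measure_mono (subset_iUnion K n))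

end Analytic

/-! ### Inf-convolutions -/

section InfConv

variable {X : Type*}

theorem bddBelow_infConv {c : X → X → ℝ} (hc : ∀ x y, 0 ≤ c x y) {f : X → ℝ} {M : ℝ}
    (hf : ∀ x, |f x| ≤ M) (x : X) : BddBelow (range fun y => f y + c x y) := by
  refine ⟨-M, ?_⟩
  rintro _ ⟨y, rfl⟩
  exact (neg_le_of_abs_le (hf y)).trans (le_add_of_nonneg_right (hc x y))

theorem abs_infConv_le {c : X → X → ℝ} (hc : ∀ x y, 0 ≤ c x y) (hc0 : ∀ x, c x x = 0)
    {f : X → ℝ} {M : ℝ} (hf : ∀ x, |f x| ≤ M) (x : X) : |infConv c f x| ≤ M := by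
  have : Nonempty X := ⟨x⟩
  refine abs_le.2 ⟨le_ciInf fun y => ?_, ?_⟩
  · exact (neg_le_of_abs_le (hf y)).trans (le_add_of_nonneg_right (hc x y))
  · refine (ciInf_le (bddBelow_infConv hc hf x) x).trans ?_
    simpa [hc0] using le_of_abs_le (hf x)

/-- The inf-convolution of a bounded Borel function with a nonnegative Borel cost is universally
measurable. -/
theorem aemeasurable_infConv [TopologicalSpace X] [PolishSpace X] [MeasurableSpace X]
    [BorelSpace X] (μ : Measure X) [IsFiniteMeasure μ] {c : X → X → ℝ}
    (hcm : Measurable fun p : X × X => c p.1 p.2) (hc : ∀ x y, 0 ≤ c x y)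
    {f : X → ℝ} (hfm : Measurable f) {M : ℝ} (hf : ∀ x, |f x| ≤ M) :
    AEMeasurable (infConv c f) μ := by
  refine NullMeasurable.aemeasurable ?_
  have : @Measurable (NullMeasurableSpace X μ) ℝ _ _ (infConv c f) := by
    refine measurable_of_Iio fun t => ?_
    have hpre : infConv c f ⁻¹' Iio t
        = Prod.fst '' {p : X × X | f p.2 + c p.1 p.2 < t} := by
      ext x
      have : Nonempty X := ⟨x⟩
      simp only [mem_preimage, mem_Iio, infConv, ciInf_lt_iff (bddBelow_infConv hc hf x),
        mem_image, mem_ofPred_eq, Prod.exists, exists_and_right, exists_eq_right]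
    have hnull : NullMeasurableSet (infConv c f ⁻¹' Iio t) μ := by
      rw [hpre]
      exact nullMeasurableSet_of_analyticSet μ
        ((measurableSet_lt ((hfm.comp measurable_snd).add hcm)
          measurable_const).analyticSet_image measurable_fst)
    exact hnull
  exact fun s hs => this hs

/-- If `c' x y ≤ c x z + c z y`, then `Q_{c'} f ≤ Q_c (Q_c f)`, in the form of a pointwise bound. -/
theorem infConv_sub_infConv_le {c c' : X → X → ℝ} (hc' : ∀ x y, 0 ≤ c' x y)
    (htri : ∀ x y z, c' x y ≤ c x z + c z y) {f : X → ℝ} {M : ℝ} (hf : ∀ x, |f x| ≤ M)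
    (x z : X) : infConv c' f x - infConv c f z ≤ c x z := by
  have : Nonempty X := ⟨x⟩
  rw [sub_le_comm]
  refine le_ciInf fun y => ?_
  have := ciInf_le (bddBelow_infConv hc' hf x) y
  have := htri x y z
  simp only [infConv] at *
  linarith

end InfConv

/-! ### Entropy and duality -/

section Entropy

variable {X : Type*} [MeasurableSpace X]

/-- The relative entropy of an exponential tilting of a probability measure. -/
theorem klDiv_tilted_self {μ : Measure X} [IsProbabilityMeasure μ] {g : X → ℝ}
    (hg : AEMeasurable g μ) (hexp : Integrable (fun x => Real.exp (g x)) μ)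
    (hgt : Integrable g (μ.tilted g)) :
    InformationTheory.klDiv (μ.tilted g) μ ≠ ∞ ∧
      (InformationTheory.klDiv (μ.tilted g) μ).toReal
        = ∫ x, g x ∂(μ.tilted g) - Real.log (∫ x, Real.exp (g x) ∂μ) := by
  have hprob := isProbabilityMeasure_tilted hexp
  have hac := tilted_absolutelyContinuous μ g
  have hllr : llr (μ.tilted g) μ =ᵐ[μ.tilted g]
      fun x => g x - Real.log (∫ x, Real.exp (g x) ∂μ) := by
    refine hac.ae_le ?_
    filter_upwards [llr_tilted_left Measure.AbsolutelyContinuous.rfl hexp hg, llr_self μ]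
      with x h1 h2
    rw [h1, h2, Pi.zero_apply, add_zero]
  refine ⟨InformationTheory.klDiv_ne_top hac
    ((integrable_congr hllr).2 (hgt.sub (integrable_const _))), ?_⟩
  rw [InformationTheory.toReal_klDiv_of_measure_eq hac (by simp), integral_congr_ae hllr,
    integral_sub hgt (integrable_const _)]
  simp

/-- The elementary half of Kantorovich duality. -/
theorem ofReal_integral_sub_le_transportCost {c : X → X → ℝ} {ν μ : Measure X} {u v : X → ℝ}
    (hu : Integrable u ν) (hv : Integrable v μ) (huv : ∀ x z, u x - v z ≤ c x z) :
    ENNReal.ofReal (∫ x, u x ∂ν - ∫ z, v z ∂μ) ≤ transportCost c ν μ := by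
  refine le_iInf₂ fun π hπ => ?_
  obtain ⟨rfl, rfl⟩ := hπ
  have hu' : Integrable (fun p : X × X => u p.1) π := hu.comp_measurable measurable_fst
  have hv' : Integrable (fun p : X × X => v p.2) π := hv.comp_measurable measurable_snd
  have hw := hu'.sub hv'
  rw [integral_map measurable_fst.aemeasurable hu.1, integral_map measurable_snd.aemeasurable hv.1,
    ← integral_sub hu' hv']
  calc ENNReal.ofReal (∫ p : X × X, (u p.1 - v p.2) ∂π)
      ≤ ENNReal.ofReal (∫ p : X × X, max (u p.1 - v p.2) 0 ∂π) :=
        ENNReal.ofReal_le_ofReal (integral_mono hw hw.pos_part fun p => le_max_left _ _)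
    _ = ∫⁻ p : X × X, ENNReal.ofReal (max (u p.1 - v p.2) 0) ∂π :=
        ofReal_integral_eq_lintegral_ofReal hw.pos_part (ae_of_all _ fun p => le_max_right _ _)
    _ ≤ ∫⁻ p : X × X, ENNReal.ofReal (c p.1 p.2) ∂π := by
        refine lintegral_mono fun p => ?_
        rw [ENNReal.ofReal_max, ENNReal.ofReal_zero, max_eq_left zero_le]
        exact ENNReal.ofReal_le_ofReal (huv p.1 p.2)

/-- The dual form of a transport-entropy inequality. -/
theorem TransportEntropyInequality.lintegral_exp_le {c : X → X → ℝ} {μ : Measure X}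
    [IsProbabilityMeasure μ] (hμ : TransportEntropyInequality c μ) {u v : X → ℝ}
    (hum : AEMeasurable u μ) {M : ℝ} (hu : ∀ x, |u x| ≤ M) (hv : Integrable v μ)
    (huv : ∀ x z, u x - v z ≤ c x z) :
    ∫⁻ x, ENNReal.ofReal (Real.exp (u x)) ∂μ ≤ ENNReal.ofReal (Real.exp (∫ z, v z ∂μ)) := by
  have hexp : Integrable (fun x => Real.exp (u x)) μ :=
    Integrable.of_bound hum.exp.aestronglyMeasurable (Real.exp M) <| ae_of_all _ fun x => by
      rw [Real.norm_eq_abs, Real.abs_exp]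
      exact Real.exp_le_exp.2 (le_of_abs_le (hu x))
  have hprob := isProbabilityMeasure_tilted hexp
  have hut : Integrable u (μ.tilted u) :=
    Integrable.of_bound (hum.mono_ac (tilted_absolutelyContinuous μ u)).aestronglyMeasurable M
      (ae_of_all _ hu)
  obtain ⟨hfin, hkl⟩ := klDiv_tilted_self hum hexp hut
  -- The term `∫ u` under the tilted measure occurs on both sides and cancels, leaving `log ∫ exp u
  -- dμ ≤ ∫ v dμ`.
  have h := (ofReal_integral_sub_le_transportCost hut hv huv).trans (hμ _ hprob)
  rw [ENNReal.ofReal_le_iff_le_toReal hfin, hkl] at h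
  rw [← ofReal_integral_eq_lintegral_ofReal hexp (ae_of_all _ fun x => (Real.exp_pos _).le)]
  refine ENNReal.ofReal_le_ofReal ?_
  rw [← Real.log_le_iff_le_exp (integral_exp_pos hexp)]
  linarith

end Entropy

/-! ### Convex functions of a metric -/

section Cost

theorem IsMetric.nonneg {X : Type*} {d : X → X → ℝ} (hd : IsMetric d) (x y : X) : 0 ≤ d x y := by
  have h1 := hd.triangle x y x
  have h2 := hd.symm x y
  have h3 := (hd.eq_zero_iff x x).2 rfl
  linarith

theorem monotoneOn_of_convexOn_Ici {θ : ℝ → ℝ} (hθ : ConvexOn ℝ (Ici 0) θ)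
    (hθ_nonneg : ∀ t, 0 ≤ t → 0 ≤ θ t) (hθ_zero : θ 0 = 0) : MonotoneOn θ (Ici 0) := by
  intro s hs t ht hst
  rcases (mem_Ici.1 ht).eq_or_lt with rfl | htpos
  · rw [le_antisymm hst hs]
  have hs1 : s / t ≤ 1 := div_le_one_of_le₀ hst ht
  -- Here `s` is the convex combination of `t` and `0` with weight `s / t` on `t`.
  have h := hθ.2 ht (mem_Ici.2 le_rfl) (div_nonneg hs ht) (sub_nonneg.2 hs1) (by ring)
  simp only [smul_eq_mul, mul_zero, add_zero, hθ_zero, div_mul_cancel₀ s htpos.ne'] at h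
  exact h.trans (mul_le_of_le_one_left (hθ_nonneg t ht) hs1)

theorem measurable_comp_of_monotoneOn_Ici {Y : Type*} [MeasurableSpace Y] {θ : ℝ → ℝ}
    (hθ : MonotoneOn θ (Ici 0)) {g : Y → ℝ} (hg : Measurable g) (hg0 : ∀ y, 0 ≤ g y) :
    Measurable fun y => θ (g y) := by
  -- Nothing is known of `θ` on negative reals, so it is replaced there by `θ 0`.
  have hmono : Monotone fun t => θ (max t 0) := fun s t hst =>
    hθ (mem_Ici.2 (le_max_right _ _)) (mem_Ici.2 (le_max_right _ _)) (max_le_max_right 0 hst)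
  have h := hmono.measurable.comp hg
  simpa only [Function.comp_def, max_eq_left (hg0 _)] using h

/-- By the triangle inequality `d x y / 2` is at most the midpoint of `d x z` and `d z y`;
monotonicity, then convexity, conclude. -/
theorem two_mul_half_le_add {X : Type*} {d : X → X → ℝ} (hd : IsMetric d) {θ : ℝ → ℝ}
    (hθ : ConvexOn ℝ (Ici 0) θ) (hmono : MonotoneOn θ (Ici 0)) (x y z : X) :
    2 * θ (d x y / 2) ≤ θ (d x z) + θ (d z y) := by
  have h1 : θ (d x y / 2) ≤ θ ((1 / 2 : ℝ) • d x z + (1 / 2 : ℝ) • d z y) := by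
    have := hd.nonneg x y
    have := hd.nonneg x z
    have := hd.nonneg z y
    have := hd.triangle x z y
    refine hmono (mem_Ici.2 (by linarith)) (mem_Ici.2 ?_) ?_ <;> simp only [smul_eq_mul] <;>
      linarith
  have h2 := hθ.2 (mem_Ici.2 (hd.nonneg x z)) (mem_Ici.2 (hd.nonneg z y))
    (by norm_num : (0 : ℝ) ≤ 1 / 2) (by norm_num : (0 : ℝ) ≤ 1 / 2) (by norm_num)
  simp only [smul_eq_mul] at h1 h2
  linarith

end Cost

end TransportTau

theorem mainTheorem8 {X : Type*} [TopologicalSpace X] [PolishSpace X]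
    [MeasurableSpace X] [BorelSpace X]
    (d : X → X → ℝ) (hd : TransportTau.IsMetric d)
    (hd_lsc : LowerSemicontinuous (fun p : X × X => d p.1 p.2))
    (μ : Measure X) [IsProbabilityMeasure μ]
    (θ : ℝ → ℝ) (hθ_convex : ConvexOn ℝ (Ici 0) θ) (hθ_nonneg : ∀ t, 0 ≤ t → 0 ≤ θ t)
    (hθ_zero : θ 0 = 0)
    (hμ : TransportTau.TransportEntropyInequality (fun x y => θ (d x y)) μ) :
    TransportTau.PropertyTau μ (fun x y => 2 * θ (d x y / 2)) := by
  have hd0 := hd.nonneg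
  have hmono := TransportTau.monotoneOn_of_convexOn_Ici hθ_convex hθ_nonneg hθ_zero
  have hdm : Measurable fun p : X × X => d p.1 p.2 := hd_lsc.measurable
  intro f hfm ⟨M, hf⟩
  have hc : ∀ x y, 0 ≤ θ (d x y) := fun x y => hθ_nonneg _ (hd0 x y)
  have hc0 : ∀ x, θ (d x x) = 0 := fun x => by rw [(hd.eq_zero_iff x x).2 rfl, hθ_zero]
  have hc' : ∀ x y, 0 ≤ 2 * θ (d x y / 2) := fun x y =>
    mul_nonneg zero_le_two (hθ_nonneg _ (by linarith [hd0 x y]))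
  have hc0' : ∀ x, 2 * θ (d x x / 2) = 0 := fun x => by
    rw [(hd.eq_zero_iff x x).2 rfl, zero_div, hθ_zero, mul_zero]
  have hQ' : AEMeasurable (TransportTau.infConv (fun x y => 2 * θ (d x y / 2)) f) μ :=
    TransportTau.aemeasurable_infConv μ
      ((TransportTau.measurable_comp_of_monotoneOn_Ici hmono (hdm.div_const 2)
        fun p => by linarith [hd0 p.1 p.2]).const_mul 2) hc' hfm hf
  have hQ : AEMeasurable (TransportTau.infConv (fun x y => θ (d x y)) f) μ :=
    TransportTau.aemeasurable_infConv μ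
      (TransportTau.measurable_comp_of_monotoneOn_Ici hmono hdm fun p => hd0 p.1 p.2) hc hfm hf
  have hQint : Integrable (TransportTau.infConv (fun x y => θ (d x y)) f) μ :=
    Integrable.of_bound hQ.aestronglyMeasurable M
      (ae_of_all _ (TransportTau.abs_infConv_le hc hc0 hf))
  refine ⟨hQ', ?_⟩
  have h1 := hμ.lintegral_exp_le hQ' (TransportTau.abs_infConv_le hc' hc0' hf) hQint
    (TransportTau.infConv_sub_infConv_le hc'
      (TransportTau.two_mul_half_le_add hd hθ_convex hmono) hf)
  -- The choice `y = x` in the infimum defining `Q_c f z` gives a cost `θ (d z x)`, hence the use of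
  -- symmetry.
  have h2 := hμ.lintegral_exp_le (u := fun x => -f x) (M := M) hfm.neg.aemeasurable
    (fun x => by rw [abs_neg]; exact hf x) hQint.neg (fun x z => by
      have h : TransportTau.infConv (fun x y => θ (d x y)) f z ≤ f x + θ (d z x) :=
        ciInf_le (TransportTau.bddBelow_infConv hc hf z) x
      rw [hd.symm x z, Pi.neg_apply]
      linarith)
  refine (mul_le_mul' h1 h2).trans_eq ?_
  rw [← ENNReal.ofReal_mul (Real.exp_pos _).le, ← Real.exp_add]
  simp only [Pi.neg_apply, integral_neg, add_neg_cancel, Real.exp_zero, ENNReal.ofReal_one]
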